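/- Let $\mathcal Y$ be a finite nonempty set and let $\phi:\mathcal Y\to\{0,1\}^d$ be a feature map. For $\theta\in\mathbb R^d$ let $p_\theta(y)=\exp\{\phi(y)^\top\theta-A(\theta)\}$ with $A(\theta)=\log\sum_{y\in\mathcal Y}\exp\{\phi(y)^\top\theta\}$. Let $\theta^*\in\mathbb R^d$ be the true parameter, and assume that the Fisher information matrix $\mathcal I=\operatorname{cov}_{y\sim p_{\theta^*}}[\phi(y)]$ is invertible. For $t>0$ put $q_t=e^{t/2}/(1+e^{t/2})$. Let $\alpha>0$, let $\delta=\sup_{y}\sup_{\tilde o}\|\tilde o\|_1$, where $\tilde o$ ranges over the support of the binarized statistics given $y$ (independent bits with $\tilde o[j]\sim\mathrm{Bernoulli}(\phi(y)[j])$, so that $\tilde o=\phi(y)$ because $\phi$ is binary), let $\bar\delta\ge\delta$ with $\bar\delta>0$, and put $q=q_{\alpha/\bar\delta}$. The per-value $\phi$-randomized response channel $S(\cdot\mid y)$ draws $\tilde o$ given $y$ and releases $o\in\{0,1\}^d$, where, independently over $j$, $o[j]=\tilde o[j]$ with probability $q$ and $o[j]=1-\tilde o[j]$ otherwise. The associated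 observation function is $\beta(o)=\dfrac{o-\mathbf 1+q\mathbf 1}{2q-1}$. Let $(y^{(i)},o^{(i)})$, $i=1,2,\dots$, be i.i.d. with $y^{(i)}\sim p_{\theta^*}$ and $o^{(i)}\sim S(\cdot\mid y^{(i)})$, let $\hat\mu_n=\frac1n\sum_{i=1}^n\beta(o^{(i)})$, and let the moments-based estimator be $$\hat\theta_n\in\arg\max_{\theta\in\mathbb R^d}\{\hat\mu_n^\top\theta-A(\theta)\},$$ a function of $o^{(1)},\dots,o^{(n)}$ (with an arbitrary value on the samples for which no maximizer exists). **Theorem (Asymptotic variance (per-value $\phi$-RR)).** The channel $S$ is $\alpha$-differentially private, i.e. $S(o\mid y)\le e^{\alpha}S(o\mid y')$ for all $o,y,y'$, and $$\sqrt n\,(\hat\theta_n-\theta^*)\ \xrightarrow{\ d\ }\ \mathcal N\bigl(0,\ \mathcal I^{-1}+\mathcal I^{-1}H\,\mathcal I^{-1}\bigr),\qquad H=\frac{q(1-q)}{(2q-1)^2}\,\mathrm{Id}_d,$$ where $\mathrm{Id}_d$ is the $d\times d$ identity matrix. -/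

import Mathlib

open MeasureTheory ProbabilityTheory Filter
open scoped ENNReal Topology

noncomputable section

namespace PerValueRR

/-! ### The exponential family -/

section Model

variable {Y : Type*} [Fintype Y] {d : ℕ}

/-- The log-partition function `A(θ) = log ∑_y exp (φ(y)ᵀ θ)`. -/
def logPartition (φ : Y → EuclideanSpace ℝ (Fin d)) (θ : EuclideanSpace ℝ (Fin d)) : ℝ :=
  Real.log (∑ y, Real.exp (inner ℝ (φ y) θ))

theorem sum_density [Nonempty Y] (φ : Y → EuclideanSpace ℝ (Fin d))
    (θ : EuclideanSpace ℝ (Fin d)) :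
    ∑ y, ENNReal.ofReal (Real.exp (inner ℝ (φ y) θ - logPartition φ θ)) = 1 := by
  have hpos : 0 < ∑ y, Real.exp (inner ℝ (φ y) θ) :=
    Finset.sum_pos (fun y _ => Real.exp_pos _) Finset.univ_nonempty
  rw [← ENNReal.ofReal_sum_of_nonneg (fun y _ => (Real.exp_pos _).le)]
  simp only [Real.exp_sub, logPartition, Real.exp_log hpos]
  rw [← Finset.sum_div, div_self hpos.ne', ENNReal.ofReal_one]

/-- The exponential family `p_θ(y) = exp (φ(y)ᵀ θ - A(θ))` on the finite set `Y`. -/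
def model [Nonempty Y] (φ : Y → EuclideanSpace ℝ (Fin d)) (θ : EuclideanSpace ℝ (Fin d)) :
    PMF Y :=
  PMF.ofFintype (fun y => ENNReal.ofReal (Real.exp (inner ℝ (φ y) θ - logPartition φ θ)))
    (sum_density φ θ)

/-- The Fisher information matrix `cov[φ(y)]`, where `y ∼ p_θ`. -/
def fisherInfo [Nonempty Y] [MeasurableSpace Y] (φ : Y → EuclideanSpace ℝ (Fin d))
    (θ : EuclideanSpace ℝ (Fin d)) : Matrix (Fin d) (Fin d) ℝ :=
  Matrix.of fun i j => cov[fun y => φ y i, fun y => φ y j; (model φ θ).toMeasure]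

end Model

/-! ### The privacy mechanism -/

/-- Bit vectors of length `d`; `true` stands for `1` and `false` for `0`. -/
abbrev Bits (d : ℕ) : Type := Fin d → Bool

/-- The real number `0` or `1` that a bit stands for. -/
def bitVal (b : Bool) : ℝ := if b then 1 else 0

theorem sum_bernoulliVec {d : ℕ} (p : Fin d → unitInterval) :
    ∑ t : Bits d, ∏ j, ENNReal.ofReal (if t j then (p j : ℝ) else 1 - (p j : ℝ)) = 1 := by
  have h := Finset.prod_univ_sum (fun _ : Fin d => (Finset.univ : Finset Bool))
    (fun j b => ENNReal.ofReal (if b then (p j : ℝ) else 1 - (p j : ℝ)))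
  rw [Fintype.piFinset_univ] at h
  rw [← h]
  refine Finset.prod_eq_one fun j _ => ?_
  have h0 := (p j).2.1
  have h1 := (p j).2.2
  simp only [Fintype.sum_bool, if_true, Bool.false_eq_true, if_false]
  rw [← ENNReal.ofReal_add h0 (by linarith)]
  simp

/-- A random bit vector with independent coordinates, the `j`-th one being `1` with
probability `p j`. -/
def bernoulliVec {d : ℕ} (p : Fin d → unitInterval) : PMF (Bits d) :=
  PMF.ofFintype (fun t => ∏ j, ENNReal.ofReal (if t j then (p j : ℝ) else 1 - (p j : ℝ)))
    (sum_bernoulliVec p)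

/-- `q_t = e^{t/2} / (1 + e^{t/2})`. -/
def q (t : ℝ) : ℝ := Real.exp (t / 2) / (1 + Real.exp (t / 2))

theorem q_mem (t : ℝ) : q t ∈ unitInterval := by
  have h := Real.exp_pos (t / 2)
  exact ⟨by unfold q; positivity, by unfold q; rw [div_le_one (by positivity)]; linarith⟩

/-- Each bit is kept with probability `q_t` and replaced by its opposite with probability
`1 - q_t`, independently over the coordinates. -/
def flipBits {d : ℕ} (t : ℝ) (b : Bits d) : PMF (Bits d) :=
  bernoulliVec fun j => if b j then ⟨q t, q_mem t⟩ else unitInterval.symm ⟨q t, q_mem t⟩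

section Mechanism

variable {Y : Type*} {d : ℕ}

/-- Binarization of the statistics: independent bits, the `j`-th one being `1` with
probability `φ(y)[j] / c`. The projection to `[0, 1]` has no effect on features with values
in `[0, c]`. -/
def binarize (c : ℝ) (φ : Y → EuclideanSpace ℝ (Fin d)) (y : Y) : PMF (Bits d) :=
  bernoulliVec fun j => Set.projIcc 0 1 zero_le_one (φ y j / c)

/-- `δ = sup ‖õ‖₁` over all `y` and all `õ` in the support of the binarization given `y`. -/
def normBound (c : ℝ) (φ : Y → EuclideanSpace ℝ (Fin d)) : ℝ :=
  sSup {r | ∃ y, ∃ t ∈ (binarize c φ y).support, r = ∑ j, |bitVal (t j)|}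

/-- The per-value `φ`-randomized response channel `S(· ∣ y)` with privacy parameter `α` and
norm bound `δ'`: binarize, then flip every bit independently with probability
`1 - q_{α/δ'}`. -/
def perValueRR (c α δ' : ℝ) (φ : Y → EuclideanSpace ℝ (Fin d)) (y : Y) : PMF (Bits d) :=
  (binarize c φ y).bind (flipBits (α / δ'))

/-- The channel `S` is `α`-differentially private: `S(o ∣ y) / S(o ∣ y') ≤ e^α` for all
`o, y, y'`. -/
def IsDifferentiallyPrivate {O : Type*} (α : ℝ) (S : Y → PMF O) : Prop :=
  ∀ (y y' : Y) (o : O), S y o ≤ ENNReal.ofReal (Real.exp α) * S y' o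

/-- The law of the pair `(y, o)`, where `y ∼ p` and `o ∼ S(· ∣ y)`. -/
def jointLaw {O : Type*} (p : PMF Y) (S : Y → PMF O) : PMF (Y × O) :=
  p.bind fun y => (S y).map fun o => (y, o)

end Mechanism

/-! ### The moments-based estimator -/

/-- The observation function of per-value `φ`-randomized response,
`β(o) = c (o - 𝟏 + q 𝟏) / (2 q - 1)` with `q = q_{α/δ'}`. -/
def obsFun {d : ℕ} (c α δ' : ℝ) (o : Bits d) : EuclideanSpace ℝ (Fin d) :=
  WithLp.toLp 2 fun j => (bitVal (o j) - 1 + q (α / δ')) / (2 * q (α / δ') - 1) * c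

/-- The estimated sufficient statistics: the empirical mean of `β(o)`. -/
def empMoment {d n : ℕ} {O : Type*} (β : O → EuclideanSpace ℝ (Fin d)) (o : Fin n → O) :
    EuclideanSpace ℝ (Fin d) :=
  (n : ℝ)⁻¹ • ∑ i, β (o i)

/-- `est`, a function of the observed samples of every size, is a moments-based estimator:
its value maximizes `θ ↦ μ̂ᵀ θ - A(θ)` over `ℝᵈ`, with `μ̂` the empirical mean of `β(o)`,
for every sample for which a maximizer exists. On the remaining samples the `arg max` is
undefined and the value of `est` is arbitrary. -/
def IsMomentEstimator {Y O : Type*} [Fintype Y] {d : ℕ} (φ : Y → EuclideanSpace ℝ (Fin d))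
    (β : O → EuclideanSpace ℝ (Fin d))
    (est : (n : ℕ) → (Fin n → O) → EuclideanSpace ℝ (Fin d)) : Prop :=
  ∀ (n : ℕ) (o : Fin n → O),
    (∃ θ, IsMaxOn (fun θ => inner ℝ (empMoment β o) θ - logPartition φ θ) Set.univ θ) →
      IsMaxOn (fun θ => inner ℝ (empMoment β o) θ - logPartition φ θ) Set.univ (est n o)

/-- `H = q (1 - q) / (2 q - 1)² • 1` with `q = q_{α/δ'}`. -/
def lossMatrix (d : ℕ) (α δ' : ℝ) : Matrix (Fin d) (Fin d) ℝ :=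
  (q (α / δ') * (1 - q (α / δ')) / (2 * q (α / δ') - 1) ^ 2) • (1 : Matrix (Fin d) (Fin d) ℝ)

end PerValueRR

end

/-! Privacy. Since `q/(1-q) = e^{t/2}`, changing one input bit changes the probability of a released
bit by a factor of at most `e^{t/2}`. The binary vectors `φ(y)` and `φ(y')` differ in at most
`‖φ(y)‖₁ + ‖φ(y')‖₁ ≤ 2δ'` places, so with `t = α/δ'` the total factor is at most `e^α`
(`flipProb_le`).

Asymptotics. Given `y`, the vector `β(o)` is `φ(y)` plus centred noise with independent coordinates
of variance `q(1-q)/(2q-1)²`. Hence `β(o)` has mean `∇A(θ*)` and covariance `I + H`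
(`integral_obsFun`, `covariance_obsFun`), and the central limit theorem applies to the empirical
moment.

The derivative of `∇A` is the Fisher information, so by the inverse function theorem `∇A` has a
local inverse `h` at `∇A(θ*)`, with derivative `I⁻¹`. Convexity of `A` makes `h(μ)` the unique
maximizer of `μᵀθ - A(θ)` for `μ` near `∇A(θ*)` (`exists_momentInverse`). By the strong law the
empirical moment almost surely enters this neighbourhood for good, so the estimator is eventually
`h` of the moment. The delta method gives the limit covariance `I⁻¹(I + H)I⁻¹ = I⁻¹ + I⁻¹HI⁻¹`. -/

namespace PerValueRR

/-! ### Limit theorems: central limit theorem and delta method. -/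

section Limits

variable {Ω : Type*} [MeasurableSpace Ω] {P : Measure Ω} [IsProbabilityMeasure P]

/-- **Multivariate central limit theorem**, with the limit law `ν` described by its characteristic
function. -/
theorem tendstoInDistribution_sqrt_smul_mean_sub {E : Type*} [NormedAddCommGroup E]
    [InnerProductSpace ℝ E] [FiniteDimensional ℝ E] [MeasurableSpace E] [BorelSpace E]
    {ν : Measure E} [IsProbabilityMeasure ν] {X : ℕ → Ω → E} (hX : MemLp (X 0) 2 P)
    (hindep : iIndepFun X P) (hident : ∀ i, IdentDistrib (X i) (X 0) P P)
    (hν : ∀ t, charFun ν t = Complex.exp (-(Var[fun ω => inner ℝ (X 0 ω) t; P] : ℂ) / 2)) :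
    TendstoInDistribution
      (fun (n : ℕ) ω => √(n : ℝ) • ((n : ℝ)⁻¹ • (∑ i ∈ Finset.range n, X i ω) - P[X 0]))
      atTop id (fun _ => P) ν := by
  have hXm : ∀ i, AEMeasurable (X i) P := fun i => (hident i).aemeasurable_fst
  have hm : ∀ n : ℕ, AEMeasurable (fun ω =>
      √(n : ℝ) • ((n : ℝ)⁻¹ • (∑ i ∈ Finset.range n, X i ω) - P[X 0])) P := fun n =>
    (((Finset.aemeasurable_fun_sum _ fun i _ => hXm i).const_smul _).sub_const _).const_smul _
  refine ⟨hm, aemeasurable_id, ?_⟩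
  refine ProbabilityMeasure.tendsto_iff_tendsto_charFun.2 fun t => ?_
  have hmeas : Measurable fun x : E => inner ℝ x t := by fun_prop
  set V := Var[fun ω => inner ℝ (X 0 ω) t; P] with hV
  -- Cramér–Wold: the characteristic function of the vector at `t` is that of its projection onto
  -- `t` at `1`, so the scalar theorem suffices.
  have h1 := tendstoInDistribution_inv_sqrt_mul_sum_sub (P := P)
    (X := fun i ω => inner ℝ (X i ω) t) (Y := id) (P' := gaussianReal 0 V.toNNReal)
    HasLaw.id (hX.inner_const t) (hindep.comp (fun _ x => inner ℝ x t) fun _ => hmeas)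
    (fun i => (hident i).comp hmeas)
  have h2 := ProbabilityMeasure.tendsto_iff_tendsto_charFun.1 h1.tendsto 1
  have hlim : charFun (gaussianReal 0 V.toNNReal) 1 = charFun ν t := by
    rw [charFun_gaussianReal, hν, Real.coe_toNNReal _ (variance_nonneg _ _)]
    congr 1
    push_cast
    ring
  have hint : Integrable (X 0) P := hX.integrable one_le_two
  simp only [ProbabilityMeasure.coe_mk, Measure.map_id] at h2 ⊢
  rw [hlim] at h2
  refine h2.congr fun n => ?_
  rw [charFun_apply, charFun_apply,
    integral_map (h1.forall_aemeasurable n) (by fun_prop),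
    integral_map (hm n) (by fun_prop)]
  refine integral_congr_ae (ae_of_all _ fun ω => ?_)
  have hmean : ∫ ω, inner ℝ (X 0 ω) t ∂P = inner ℝ (P[X 0]) t := by
    simp_rw [real_inner_comm t]
    exact integral_inner hint t
  rcases Nat.eq_zero_or_pos n with rfl | hn
  · simp
  have hn' : (0 : ℝ) < n := Nat.cast_pos.2 hn
  have hs : √(n : ℝ) * √(n : ℝ) = n := Real.mul_self_sqrt hn'.le
  have hs0 : √(n : ℝ) ≠ 0 := (Real.sqrt_pos.2 hn').ne'
  have : (√(n : ℝ))⁻¹ * (∑ k ∈ Finset.range n, inner ℝ (X k ω) t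
        - n * ∫ ω, inner ℝ (X 0 ω) t ∂P) =
      inner ℝ (√(n : ℝ) • ((n : ℝ)⁻¹ • (∑ i ∈ Finset.range n, X i ω) - P[X 0])) t := by
    rw [hmean, real_inner_smul_left, inner_sub_left, real_inner_smul_left, sum_inner]
    field_simp
    rw [pow_two, hs]
  simp only [this]
  simp

/-- **Delta method**, for a sequence `Θ n` that is eventually the value at `X n` of a function `h`
which is differentiable at the limit of `X n`. -/
theorem tendstoInDistribution_delta {E F : Type*}
    [NormedAddCommGroup E] [NormedSpace ℝ E] [MeasurableSpace E] [BorelSpace E]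
    [SecondCountableTopology E]
    [NormedAddCommGroup F] [NormedSpace ℝ F] [MeasurableSpace F] [BorelSpace F]
    [SecondCountableTopology F]
    {ν : Measure E} [IsProbabilityMeasure ν] {X : ℕ → Ω → E} {Θ : ℕ → Ω → F} {h : E → F}
    {L : E →L[ℝ] F} {a : E} (hh : HasFDerivAt h L a)
    (hXm : ∀ n, AEMeasurable (X n) P) (hΘm : ∀ n, AEMeasurable (Θ n) P)
    (hXa : ∀ᵐ ω ∂P, Tendsto (fun n => X n ω) atTop (𝓝 a))
    (hΘ : ∀ᵐ ω ∂P, ∀ᶠ n in atTop, Θ n ω = h (X n ω))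
    (hX : TendstoInDistribution (fun (n : ℕ) ω => √(n : ℝ) • (X n ω - a)) atTop id
      (fun _ => P) ν) :
    TendstoInDistribution (fun (n : ℕ) ω => √(n : ℝ) • (Θ n ω - h a)) atTop L
      (fun _ => P) ν := by
  set T : ℕ → Ω → E := fun n ω => √(n : ℝ) • (X n ω - a) with hT
  set U : ℕ → Ω → F := fun n ω => √(n : ℝ) • (Θ n ω - h a) - L (T n ω) with hU
  -- `R` is the linearization error relative to `‖T‖`. It tends to `0` almost surely by
  -- differentiability, so no tightness of `T` is needed.
  set R : ℕ → Ω → F := fun n ω => ‖T n ω‖⁻¹ • U n ω with hR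
  have hTm : ∀ n, AEMeasurable (T n) P := fun n => ((hXm n).sub_const a).const_smul _
  have hUm : ∀ n, AEMeasurable (U n) P := fun n =>
    (((hΘm n).sub_const (h a)).const_smul _).sub (L.measurable.comp_aemeasurable (hTm n))
  have hRm : ∀ n, AEMeasurable (R n) P := fun n => (hTm n).norm.inv.smul (hUm n)
  have hDm : ∀ n, AEMeasurable (fun ω => U n ω - ‖T n ω‖ • R n ω) P := fun n =>
    (hUm n).sub ((hTm n).norm.smul (hRm n))
  have hsmall : ∀ᵐ ω ∂P, ∀ ε > 0, ∀ᶠ n in atTop, ‖U n ω‖ ≤ ε * ‖T n ω‖ := by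
    filter_upwards [hXa, hΘ] with ω h1 h2 ε hε
    filter_upwards [h1.eventually (hh.isLittleO.def hε), h2] with n h3 h4
    simp only [hU, hT, h4, map_smul, ← smul_sub, norm_smul]
    rw [mul_left_comm]
    exact mul_le_mul_of_nonneg_left h3 (norm_nonneg _)
  have hpair : ∀ᵐ ω ∂P, Tendsto (fun n => (R n ω, U n ω - ‖T n ω‖ • R n ω)) atTop
      (𝓝 ((0 : F), (0 : F))) := by
    filter_upwards [hsmall] with ω hω
    refine Tendsto.prodMk_nhds ?_ ?_
    · rw [Metric.tendsto_nhds]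
      intro ε hε
      filter_upwards [hω (ε / 2) (by positivity)] with n hn
      rw [dist_zero_right, hR]
      simp only [norm_smul, norm_inv, norm_norm]
      rcases eq_or_ne (‖T n ω‖) 0 with h0 | h0
      · simp [h0, hε]
      · have : 0 < ‖T n ω‖ := lt_of_le_of_ne (norm_nonneg _) h0.symm
        calc ‖T n ω‖⁻¹ * ‖U n ω‖ ≤ ‖T n ω‖⁻¹ * (ε / 2 * ‖T n ω‖) := by gcongr
          _ = ε / 2 := by field_simp
          _ < ε := half_lt_self hε
    -- `U - ‖T‖ • R` can be nonzero only where `T = 0`, since `0⁻¹ = 0`; eventually `‖U‖ ≤ ‖T‖`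
    -- excludes this.
    · refine tendsto_const_nhds.congr' ?_
      filter_upwards [hω 1 one_pos] with n hn
      rcases eq_or_ne (‖T n ω‖) 0 with h0 | h0
      · rw [h0, mul_zero] at hn
        simp [norm_le_zero_iff.1 hn, h0]
      · simp only [hR]
        rw [smul_inv_smul₀ h0, sub_self]
  have hmeasure : TendstoInMeasure P (fun n ω => (R n ω, U n ω - ‖T n ω‖ • R n ω)) atTop
      (fun _ => ((0 : F), (0 : F))) :=
    tendstoInMeasure_of_tendsto_ae
      (fun n => ((hRm n).prodMk (hDm n)).aestronglyMeasurable) hpair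
  -- Slutsky: the rescaled error `√n (Θ - h a)` is `L T + ‖T‖ R + (U - ‖T‖ R)`, a continuous
  -- function of `T` and of a pair tending to zero in probability.
  have := hX.continuous_comp_prodMk_of_tendstoInMeasure_const
    (g := fun x : E × (F × F) => L x.1 + ‖x.1‖ • x.2.1 + x.2.2) (by fun_prop) hmeasure
    (fun n => (hRm n).prodMk (hDm n))
  convert! this using 1
  · ext n ω
    simp only [hU, hT]
    abel
  · ext x
    simp

end Limits

/-- The image of a centered Gaussian law under the linear map with matrix `M`. -/
theorem map_toEuclideanCLM_multivariateGaussian {ι : Type*} [Fintype ι] [DecidableEq ι]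
    {S : Matrix ι ι ℝ} (hS : S.PosSemidef) (M : Matrix ι ι ℝ) :
    (multivariateGaussian 0 S).map (Matrix.toEuclideanCLM (𝕜 := ℝ) M) =
      multivariateGaussian 0 (M * S * M.transpose) := by
  have hS' : (M * S * M.transpose).PosSemidef := by
    simpa using hS.mul_mul_conjTranspose_same M
  refine Measure.ext_of_charFun ?_
  ext t
  have h1 : charFun ((multivariateGaussian 0 S).map (Matrix.toEuclideanCLM (𝕜 := ℝ) M)) t =
      charFun (multivariateGaussian 0 S) (Matrix.toEuclideanCLM (𝕜 := ℝ) M.transpose t) := by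
    rw [charFun_apply, charFun_apply, integral_map (by fun_prop) (by fun_prop)]
    refine integral_congr_ae (ae_of_all _ fun x => ?_)
    simp only [real_inner_comm t, Matrix.inner_toEuclideanCLM]
    rw [Matrix.mulVec_transpose, Matrix.dotProduct_mulVec, dotProduct_comm]
  rw [h1, charFun_multivariateGaussian hS, charFun_multivariateGaussian hS']
  simp only [inner_zero_right, Matrix.ofLp_toEuclideanCLM]
  congr 4
  rw [Matrix.mulVec_transpose, ← Matrix.dotProduct_mulVec, ← Matrix.mulVec_transpose,
    Matrix.mulVec_mulVec, Matrix.mulVec_mulVec, Matrix.mul_assoc]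

/-! ### The mean map `∇A`, its derivative and its local inverse. -/

section MeanParameter

variable {Y : Type*} [Fintype Y] {d : ℕ}

/-- The partition function `Z(θ) = ∑_y exp (φ(y)ᵀ θ)`. -/
noncomputable def partition (φ : Y → EuclideanSpace ℝ (Fin d))
    (θ : EuclideanSpace ℝ (Fin d)) : ℝ :=
  ∑ y, Real.exp (inner ℝ (φ y) θ)

/-- The probability `p_θ(y)` as a real number. -/
noncomputable def density (φ : Y → EuclideanSpace ℝ (Fin d)) (θ : EuclideanSpace ℝ (Fin d))
    (y : Y) : ℝ :=
  Real.exp (inner ℝ (φ y) θ - logPartition φ θ)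

/-- The mean parameter `∑_y p_θ(y) φ(y)`, which is the gradient of the log-partition function. -/
noncomputable def meanParam (φ : Y → EuclideanSpace ℝ (Fin d)) (θ : EuclideanSpace ℝ (Fin d)) :
    EuclideanSpace ℝ (Fin d) :=
  ∑ y, density φ θ y • φ y

variable (φ : Y → EuclideanSpace ℝ (Fin d)) (θ : EuclideanSpace ℝ (Fin d))

theorem density_pos (y : Y) : 0 < density φ θ y := Real.exp_pos _

variable [Nonempty Y]

theorem partition_pos : 0 < partition φ θ :=
  Finset.sum_pos (fun _ _ => Real.exp_pos _) Finset.univ_nonempty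

theorem density_eq (y : Y) : density φ θ y = (partition φ θ)⁻¹ * Real.exp (inner ℝ (φ y) θ) := by
  rw [density, Real.exp_sub, logPartition, ← partition, Real.exp_log (partition_pos φ θ),
    div_eq_inv_mul]

theorem sum_density_eq_one : ∑ y, density φ θ y = 1 := by
  simp_rw [density_eq, ← Finset.mul_sum]
  exact inv_mul_cancel₀ (partition_pos φ θ).ne'

theorem toReal_model (y : Y) : (model φ θ y).toReal = density φ θ y :=
  ENNReal.toReal_ofReal (Real.exp_pos _).le

theorem integral_model [MeasurableSpace Y] [MeasurableSingletonClass Y] (f : Y → ℝ) :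
    ∫ y, f y ∂(model φ θ).toMeasure = ∑ y, density φ θ y * f y := by
  simp [PMF.integral_eq_sum, toReal_model]

theorem fisherInfo_apply [MeasurableSpace Y] [MeasurableSingletonClass Y] (i j : Fin d) :
    fisherInfo φ θ i j =
      ∑ y, density φ θ y * ((φ y i - meanParam φ θ i) * (φ y j - meanParam φ θ j)) := by
  simp [fisherInfo, covariance, integral_model, meanParam]

theorem fisherInfo_mulVec [MeasurableSpace Y] [MeasurableSingletonClass Y]
    (w : EuclideanSpace ℝ (Fin d)) :
    Matrix.toEuclideanCLM (𝕜 := ℝ) (fisherInfo φ θ) w =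
      ∑ y, (density φ θ y * inner ℝ (φ y - meanParam φ θ) w) • (φ y - meanParam φ θ) := by
  ext i
  simp only [Matrix.ofLp_toEuclideanCLM, Matrix.mulVec, dotProduct, fisherInfo_apply,
    WithLp.ofLp_sum, WithLp.ofLp_smul, WithLp.ofLp_sub, Finset.sum_apply, Pi.smul_apply,
    Pi.sub_apply, smul_eq_mul, PiLp.inner_apply, RCLike.inner_apply, conj_trivial]
  simp_rw [Finset.sum_mul, Finset.mul_sum, Finset.sum_mul]
  rw [Finset.sum_comm]
  exact Finset.sum_congr rfl fun y _ => Finset.sum_congr rfl fun j _ => by ring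

theorem sum_density_smul_sub : ∑ y, density φ θ y • (φ y - meanParam φ θ) = 0 := by
  simp_rw [smul_sub, Finset.sum_sub_distrib, ← Finset.sum_smul, sum_density_eq_one, one_smul]
  exact sub_self _

/-- Quotient rule for `∇A = Z⁻¹ ∑ exp(φ(y)ᵀθ) φ(y)`. Strictness is what the inverse function theorem
requires. -/
theorem hasStrictFDerivAt_meanParam [MeasurableSpace Y] [MeasurableSingletonClass Y] :
    HasStrictFDerivAt (meanParam φ) (Matrix.toEuclideanCLM (𝕜 := ℝ) (fisherInfo φ θ)) θ := by
  have hexp : ∀ y, HasStrictFDerivAt (fun θ => Real.exp (inner ℝ (φ y) θ))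
      (Real.exp (inner ℝ (φ y) θ) • innerSL ℝ (φ y)) θ := fun y =>
    (innerSL ℝ (φ y)).hasStrictFDerivAt.exp
  have hZ : HasStrictFDerivAt (partition φ)
      (∑ y, Real.exp (inner ℝ (φ y) θ) • innerSL ℝ (φ y)) θ :=
    HasStrictFDerivAt.fun_sum fun y _ => hexp y
  have hN : HasStrictFDerivAt (fun θ => ∑ y, Real.exp (inner ℝ (φ y) θ) • φ y)
      (∑ y, (Real.exp (inner ℝ (φ y) θ) • innerSL ℝ (φ y)).smulRight (φ y)) θ :=
    HasStrictFDerivAt.fun_sum fun y _ => (hexp y).smul_const (φ y)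
  have hZ0 := (partition_pos φ θ).ne'
  have hinv := (hasStrictDerivAt_inv hZ0).comp_hasStrictFDerivAt θ hZ
  have hfun : meanParam φ = fun θ => (partition φ θ)⁻¹ • ∑ y, Real.exp (inner ℝ (φ y) θ) • φ y := by
    ext1 θ
    simp_rw [meanParam, density_eq, Finset.smul_sum, smul_smul]
  have hm : (partition φ θ)⁻¹ • ∑ y, Real.exp (inner ℝ (φ y) θ) • φ y = meanParam φ θ :=
    (congrFun hfun θ).symm
  rw [hfun]
  refine (hinv.smul hN).congr_fderiv ?_
  ext1 w
  rw [fisherInfo_mulVec]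
  -- The quotient rule produces `φ y` uncentred inside the inner product; the centring term
  -- contributes nothing because `φ y - meanParam` has mean zero.
  have h1 : ∑ y, (density φ θ y * inner ℝ (φ y - meanParam φ θ) w) • (φ y - meanParam φ θ) =
      ∑ y, (density φ θ y * inner ℝ (φ y) w) • (φ y - meanParam φ θ) := by
    have := sum_density_smul_sub φ θ
    rw [← sub_eq_zero, ← Finset.sum_sub_distrib]
    calc _ = ∑ y, (-inner ℝ (meanParam φ θ) w) • (density φ θ y • (φ y - meanParam φ θ)) :=
          Finset.sum_congr rfl fun y _ => by
            rw [← sub_smul, inner_sub_left, smul_smul]; congr 1; ring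
      _ = 0 := by rw [← Finset.smul_sum, this, smul_zero]
  rw [h1]
  simp_rw [smul_sub, Finset.sum_sub_distrib, ← Finset.sum_smul]
  conv_rhs => rw [← hm]
  simp only [add_apply, smul_apply, ContinuousLinearMap.smulRight_apply,
    sum_apply, innerSL_apply_apply, Function.comp_apply, smul_eq_mul, density_eq, smul_smul]
  rw [sub_eq_add_neg]
  congr 1
  · simp only [Finset.smul_sum, smul_smul, mul_assoc]
  · rw [← neg_smul]
    congr 1
    simp only [mul_assoc, ← Finset.mul_sum]
    ring

/-- Writes the Bregman divergence of `A` as a log-moment generating function of the centred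
statistics, so that convexity of `A` reduces to `1 + x ≤ exp x`. -/
theorem logPartition_sub_sub (θ' : EuclideanSpace ℝ (Fin d)) :
    logPartition φ θ' - logPartition φ θ - inner ℝ (meanParam φ θ) (θ' - θ) =
      Real.log (∑ y, density φ θ y * Real.exp (inner ℝ (φ y - meanParam φ θ) (θ' - θ))) := by
  have h : ∑ y, density φ θ y * Real.exp (inner ℝ (φ y - meanParam φ θ) (θ' - θ)) =
      partition φ θ' / partition φ θ * Real.exp (-inner ℝ (meanParam φ θ) (θ' - θ)) := by
    rw [div_mul_eq_mul_div, eq_div_iff (partition_pos φ θ).ne', Finset.sum_mul]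
    conv_rhs => rw [partition]
    rw [Finset.sum_mul]
    refine Finset.sum_congr rfl fun y _ => ?_
    have hZ := (partition_pos φ θ).ne'
    have hcancel : ∀ a b : ℝ, (partition φ θ)⁻¹ * a * b * partition φ θ = a * b := fun a b => by
      field_simp
    rw [density_eq, hcancel, ← Real.exp_add, ← Real.exp_add]
    congr 1
    rw [inner_sub_left, inner_sub_right]
    ring
  rw [h, Real.log_mul (div_pos (partition_pos φ θ') (partition_pos φ θ)).ne' (Real.exp_pos _).ne',
    Real.log_exp, Real.log_div (partition_pos φ θ').ne' (partition_pos φ θ).ne']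
  simp only [logPartition, partition]
  ring

theorem sum_density_mul_one_add_inner (w : EuclideanSpace ℝ (Fin d)) :
    ∑ y, density φ θ y * (1 + inner ℝ (φ y - meanParam φ θ) w) = 1 := by
  simp_rw [mul_add, mul_one, Finset.sum_add_distrib, sum_density_eq_one, ← real_inner_smul_left,
    ← sum_inner, sum_density_smul_sub, inner_zero_left, add_zero]

theorem isMaxOn_of_meanParam_eq :
    IsMaxOn (fun θ' => inner ℝ (meanParam φ θ) θ' - logPartition φ θ') Set.univ θ := by
  intro θ' _
  have h1 : 1 ≤ ∑ y, density φ θ y * Real.exp (inner ℝ (φ y - meanParam φ θ) (θ' - θ)) := by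
    rw [← sum_density_mul_one_add_inner φ θ (θ' - θ)]
    refine Finset.sum_le_sum fun y _ => mul_le_mul_of_nonneg_left ?_ (density_pos φ θ y).le
    rw [add_comm]
    exact Real.add_one_le_exp _
  have h2 := Real.log_nonneg h1
  rw [← logPartition_sub_sub, inner_sub_right] at h2
  simp only [Set.mem_ofPred_eq]
  linarith

/-- If the Fisher information is nonsingular at one parameter, then the maximizer is unique at every
attained moment. -/
theorem eq_of_isMaxOn [MeasurableSpace Y] [MeasurableSingletonClass Y]
    {θ₀ : EuclideanSpace ℝ (Fin d)} (hI : IsUnit (fisherInfo φ θ₀)) {θ' : EuclideanSpace ℝ (Fin d)}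
    (h : IsMaxOn (fun θ' => inner ℝ (meanParam φ θ) θ' - logPartition φ θ') Set.univ θ') :
    θ' = θ := by
  have h1 := h (Set.mem_univ θ)
  simp only [Set.mem_ofPred_eq] at h1
  set w := θ' - θ with hw
  have hlog : Real.log (∑ y, density φ θ y * Real.exp (inner ℝ (φ y - meanParam φ θ) w)) ≤ 0 := by
    rw [← logPartition_sub_sub, inner_sub_right]
    linarith
  have hpos : 0 < ∑ y, density φ θ y * Real.exp (inner ℝ (φ y - meanParam φ θ) w) :=
    Finset.sum_pos (fun y _ => mul_pos (density_pos φ θ y) (Real.exp_pos _)) Finset.univ_nonempty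
  have hle := (Real.log_nonpos_iff hpos.le).1 hlog
  -- A second maximizer forces equality in `1 + x ≤ exp x` at every `y`, since all densities are
  -- positive.
  have hzero : ∀ y, inner ℝ (φ y - meanParam φ θ) w = 0 := by
    by_contra! hne
    obtain ⟨y, hy⟩ := hne
    refine absurd hle (not_le.2 ?_)
    rw [← sum_density_mul_one_add_inner φ θ w]
    refine Finset.sum_lt_sum (fun y _ => mul_le_mul_of_nonneg_left ?_ (density_pos φ θ y).le)
      ⟨y, Finset.mem_univ y, mul_lt_mul_of_pos_left ?_ (density_pos φ θ y)⟩
    · rw [add_comm]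
      exact Real.add_one_le_exp _
    · rw [add_comm]
      exact Real.add_one_lt_exp hy
  -- `inner (φ y) w` is constant in `y`, so its mean is the same at every parameter; hence `w` also
  -- lies in the kernel of the Fisher information at `θ₀`.
  have hmean : inner ℝ (meanParam φ θ₀) w = inner ℝ (meanParam φ θ) w := by
    conv_lhs => rw [meanParam, sum_inner]
    simp_rw [real_inner_smul_left, fun y => sub_eq_zero.1 ((inner_sub_left (𝕜 := ℝ) (φ y)
      (meanParam φ θ) w).symm.trans (hzero y))]
    rw [← Finset.sum_mul, sum_density_eq_one, one_mul]
  have hker : (fisherInfo φ θ₀).mulVec w = 0 := by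
    have := fisherInfo_mulVec φ θ₀ w
    simp_rw [inner_sub_left, hmean, ← inner_sub_left, hzero, mul_zero, zero_smul,
      Finset.sum_const_zero] at this
    simpa using congrArg WithLp.ofLp this
  have hw0 : w.ofLp = 0 := Matrix.mulVec_injective_of_isUnit hI (by simpa using hker)
  exact sub_eq_zero.1 (hw ▸ (WithLp.ofLp_eq_zero 2).1 hw0)

/-- Near `∇A(θ₀)` the moments determine the estimate through a function with derivative
`I(θ₀)⁻¹`. -/
theorem exists_momentInverse [MeasurableSpace Y] [MeasurableSingletonClass Y]
    (hI : IsUnit (fisherInfo φ θ)) :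
    ∃ h : EuclideanSpace ℝ (Fin d) → EuclideanSpace ℝ (Fin d),
      h (meanParam φ θ) = θ ∧
      HasFDerivAt h (Matrix.toEuclideanCLM (𝕜 := ℝ) (fisherInfo φ θ)⁻¹) (meanParam φ θ) ∧
      ∀ᶠ μ in 𝓝 (meanParam φ θ),
        IsMaxOn (fun θ' => inner ℝ μ θ' - logPartition φ θ') Set.univ (h μ) ∧
        ∀ θ', IsMaxOn (fun θ' => inner ℝ μ θ' - logPartition φ θ') Set.univ θ' → θ' = h μ := by
  have hdet := (Matrix.isUnit_iff_isUnit_det _).1 hI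
  let e : EuclideanSpace ℝ (Fin d) ≃L[ℝ] EuclideanSpace ℝ (Fin d) :=
    ContinuousLinearEquiv.equivOfInverse (Matrix.toEuclideanCLM (𝕜 := ℝ) (fisherInfo φ θ))
      (Matrix.toEuclideanCLM (𝕜 := ℝ) (fisherInfo φ θ)⁻¹)
      (fun x => by
        rw [← mul_apply_eq_comp, ← map_mul, Matrix.nonsing_inv_mul _ hdet, map_one]
        rfl)
      (fun x => by
        rw [← mul_apply_eq_comp, ← map_mul, Matrix.mul_nonsing_inv _ hdet, map_one]
        rfl)
  have hd : HasStrictFDerivAt (meanParam φ) (e : _ →L[ℝ] _) θ := hasStrictFDerivAt_meanParam φ θ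
  refine ⟨hd.localInverse _ _ _, hd.localInverse_apply_image, hd.to_localInverse.hasFDerivAt, ?_⟩
  -- Every `μ` close to the true mean is the mean parameter of `h μ`, so the global facts on
  -- maximizers apply at `h μ`.
  filter_upwards [hd.eventually_right_inverse] with μ hμ
  have h1 := isMaxOn_of_meanParam_eq φ (hd.localInverse _ _ _ μ)
  have h2 := fun θ' => eq_of_isMaxOn φ (hd.localInverse _ _ _ μ) hI (θ' := θ')
  rw [hμ] at h1 h2
  exact ⟨h1, h2⟩

end MeanParameter

/-! ### Keep and flip probabilities of a single bit. -/

theorem q_pos (t : ℝ) : 0 < q t := by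
  unfold q
  positivity

theorem one_sub_q (t : ℝ) : 1 - q t = (1 + Real.exp (t / 2))⁻¹ := by
  have : (1 + Real.exp (t / 2)) ≠ 0 := by positivity
  unfold q
  field_simp
  ring

theorem two_mul_q_sub_one_ne_zero {t : ℝ} (ht : 0 < t) : 2 * q t - 1 ≠ 0 := by
  have h1 : 1 < Real.exp (t / 2) := Real.one_lt_exp_iff.2 (by linarith)
  have h2 : 2 * q t - 1 = (Real.exp (t / 2) - 1) / (1 + Real.exp (t / 2)) := by
    have : (1 + Real.exp (t / 2)) ≠ 0 := by positivity
    unfold q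
    field_simp
    ring
  rw [h2]
  exact (div_pos (by linarith) (by positivity)).ne'

/-- The probability that the bit `b` is released as `c`. -/
noncomputable def flipProb (t : ℝ) (b c : Bool) : ℝ := if c = b then q t else 1 - q t

theorem flipProb_pos (t : ℝ) (b c : Bool) : 0 < flipProb t b c := by
  unfold flipProb
  split_ifs
  · exact q_pos t
  · rw [one_sub_q]
    positivity

/-- The ratio is `1` for equal bits and `e^{±t/2}` for different ones, in which case the bit values
sum to `1`. This form of the exponent adds up over the coordinates to `ℓ¹` norms. -/
theorem flipProb_le {t : ℝ} (ht : 0 ≤ t) (b b' c : Bool) :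
    flipProb t b c ≤ Real.exp (t / 2 * (bitVal b + bitVal b')) * flipProb t b' c := by
  have h1 : 1 ≤ Real.exp (t / 2) := Real.one_le_exp (by linarith)
  have hq : q t = Real.exp (t / 2) * (1 - q t) := by
    rw [one_sub_q, q, div_eq_mul_inv]
  have h0 : 0 < 1 - q t := by
    rw [one_sub_q]
    positivity
  have h2 : Real.exp (t / 2 * (1 + 1)) = Real.exp (t / 2) * Real.exp (t / 2) := by
    rw [← Real.exp_add]
    ring_nf
  cases b <;> cases b' <;> cases c <;>
    simp [flipProb, bitVal, h2] <;> nlinarith [mul_le_mul h1 h1 zero_le_one (by linarith)]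

theorem flipBits_apply {d : ℕ} (t : ℝ) (b o : Bits d) :
    flipBits t b o = ENNReal.ofReal (∏ j, flipProb t (b j) (o j)) := by
  rw [ENNReal.ofReal_prod_of_nonneg fun j _ => (flipProb_pos t _ _).le]
  simp only [flipBits, bernoulliVec, PMF.ofFintype_apply]
  refine Finset.prod_congr rfl fun j _ => congrArg _ ?_
  cases b j <;> cases o j <;> simp [flipProb]

/-! ### The channel on binary features and its privacy. -/

section Mechanism

variable {Y : Type*} {d : ℕ}

/-- The binary features of `y` as a bit vector. -/
noncomputable def featureBits (φ : Y → EuclideanSpace ℝ (Fin d)) (y : Y) : Bits d :=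
  fun j => decide (φ y j = 1)

variable {φ : Y → EuclideanSpace ℝ (Fin d)}

theorem bitVal_featureBits (hφ : ∀ y j, φ y j = 0 ∨ φ y j = 1) (y : Y) (j : Fin d) :
    bitVal (featureBits φ y j) = φ y j := by
  rcases hφ y j with h | h <;> simp [bitVal, featureBits, h]

theorem binarize_eq_pure (hφ : ∀ y j, φ y j = 0 ∨ φ y j = 1) (y : Y) :
    binarize 1 φ y = PMF.pure (featureBits φ y) := by
  refine PMF.ext fun o => ?_
  have hfactor : ∀ j, ENNReal.ofReal (if o j then
      (Set.projIcc (0 : ℝ) 1 zero_le_one (φ y j / 1) : ℝ)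
      else 1 - (Set.projIcc (0 : ℝ) 1 zero_le_one (φ y j / 1) : ℝ)) =
      if o j = featureBits φ y j then 1 else 0 := by
    intro j
    rcases hφ y j with h | h <;> cases ho : o j <;> simp [featureBits, h]
  simp only [binarize, bernoulliVec, PMF.ofFintype_apply, PMF.pure_apply, hfactor]
  rw [Finset.prod_ite_zero]
  simp [funext_iff]

theorem perValueRR_apply (hφ : ∀ y j, φ y j = 0 ∨ φ y j = 1) (α δ' : ℝ) (y : Y) (o : Bits d) :
    perValueRR 1 α δ' φ y o =
      ENNReal.ofReal (∏ j, flipProb (α / δ') (featureBits φ y j) (o j)) := by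
  rw [perValueRR, binarize_eq_pure hφ, PMF.pure_bind, flipBits_apply]

theorem sum_bitVal_le_normBound [Finite Y] (hφ : ∀ y j, φ y j = 0 ∨ φ y j = 1) (y : Y) :
    ∑ j, bitVal (featureBits φ y j) ≤ normBound 1 φ := by
  have habs : ∀ b, |bitVal b| = bitVal b := by
    intro b
    cases b <;> simp [bitVal]
  refine le_csSup ?_ ⟨y, featureBits φ y, by simp [binarize_eq_pure hφ], by simp [habs]⟩
  -- Finiteness of `Y` bounds the set, without which `sSup` would not be an upper bound.
  refine ((Set.finite_range fun y => ∑ j, bitVal (featureBits φ y j)).subset ?_).bddAbove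
  rintro r ⟨y, o, ho, rfl⟩
  rw [binarize_eq_pure hφ, PMF.support_pure, Set.mem_singleton_iff] at ho
  exact ⟨y, by simp [ho, habs]⟩

/-- Per-value randomized response is differentially private. -/
theorem isDifferentiallyPrivate_perValueRR [Finite Y] (hφ : ∀ y j, φ y j = 0 ∨ φ y j = 1)
    {α δ' : ℝ} (hα : 0 ≤ α) (hδ' : 0 < δ') (hδ : normBound 1 φ ≤ δ') :
    IsDifferentiallyPrivate α (perValueRR 1 α δ' φ) := by
  intro y y' o
  rw [perValueRR_apply hφ, perValueRR_apply hφ, ← ENNReal.ofReal_mul (Real.exp_pos _).le]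
  refine ENNReal.ofReal_le_ofReal ?_
  have ht : 0 ≤ α / δ' := div_nonneg hα hδ'.le
  calc ∏ j, flipProb (α / δ') (featureBits φ y j) (o j)
      ≤ ∏ j, (Real.exp (α / δ' / 2 * (bitVal (featureBits φ y j) + bitVal (featureBits φ y' j))) *
          flipProb (α / δ') (featureBits φ y' j) (o j)) :=
        Finset.prod_le_prod (fun j _ => (flipProb_pos _ _ _).le) fun j _ => flipProb_le ht _ _ _
    _ = Real.exp (α / δ' / 2 * (∑ j, bitVal (featureBits φ y j) +
          ∑ j, bitVal (featureBits φ y' j))) *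
          ∏ j, flipProb (α / δ') (featureBits φ y' j) (o j) := by
        rw [Finset.prod_mul_distrib, ← Real.exp_sum, ← Finset.mul_sum, Finset.sum_add_distrib]
    _ ≤ _ := by
        refine mul_le_mul_of_nonneg_right (Real.exp_le_exp.2 ?_)
          (Finset.prod_nonneg fun j _ => (flipProb_pos _ _ _).le)
        -- One `δ'` for each of `y` and `y'`; the factor `1/2` in `q_t` absorbs the two.
        calc _ ≤ α / δ' / 2 * (δ' + δ') := by
              gcongr <;> exact (sum_bitVal_le_normBound hφ _).trans hδ
          _ = α := by field_simp; ring

end Mechanism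

/-! ### Moments of the released bits -/

section Moments

variable {d : ℕ}

/-- The unbiased estimate of a bit from its release `c`. -/
noncomputable def debias (t : ℝ) (c : Bool) : ℝ := (bitVal c - 1 + q t) / (2 * q t - 1)

theorem sum_flipProb (t : ℝ) (b : Bool) : ∑ c, flipProb t b c = 1 := by
  cases b <;> simp [flipProb]

/-- Up to sign, the error is a centred Bernoulli variable divided by `2q - 1`; its mean and variance
can be read off from this form. -/
theorem debias_sub_bitVal {t : ℝ} (ht : 0 < t) (b c : Bool) :
    debias t c - bitVal b =
      (if c = b then 1 - q t else -q t) * (if b then 1 else -1) / (2 * q t - 1) := by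
  have := two_mul_q_sub_one_ne_zero ht
  rw [debias, div_sub' this]
  congr 1
  cases b <;> cases c <;> simp [bitVal] <;> ring

theorem sum_flipProb_mul_debias {t : ℝ} (ht : 0 < t) (b : Bool) :
    ∑ c, flipProb t b c * (debias t c - bitVal b) = 0 := by
  simp only [debias_sub_bitVal ht]
  cases b <;> simp [flipProb] <;> ring

theorem sum_flipProb_mul_debias_sq {t : ℝ} (ht : 0 < t) (b : Bool) :
    ∑ c, flipProb t b c * ((debias t c - bitVal b) * (debias t c - bitVal b)) =
      q t * (1 - q t) / (2 * q t - 1) ^ 2 := by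
  simp only [debias_sub_bitVal ht]
  generalize 2 * q t - 1 = s
  cases b <;> simp [flipProb] <;> ring

/-- Independence of the coordinates: the expectation of a product is the product of the
expectations. Taking most factors equal to `1` yields all the mixed moments below. -/
theorem sum_prod_flipProb_mul_prod (t : ℝ) (b : Bits d) (f : Fin d → Bool → ℝ) :
    ∑ o : Bits d, (∏ j, flipProb t (b j) (o j)) * ∏ j, f j (o j) =
      ∏ j, ∑ c, flipProb t (b j) c * f j c := by
  rw [Finset.prod_univ_sum, Fintype.piFinset_univ]
  simp_rw [Finset.prod_mul_distrib]

theorem sum_prod_flipProb (t : ℝ) (b : Bits d) :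
    ∑ o : Bits d, ∏ j, flipProb t (b j) (o j) = 1 := by
  simpa only [Finset.prod_const_one, mul_one, sum_flipProb] using
    sum_prod_flipProb_mul_prod t b fun _ _ => 1

theorem sum_prod_flipProb_mul_debias {t : ℝ} (ht : 0 < t) (b : Bits d) (i : Fin d) :
    ∑ o : Bits d, (∏ j, flipProb t (b j) (o j)) * (debias t (o i) - bitVal (b i)) = 0 := by
  have h := sum_prod_flipProb_mul_prod t b fun j c => if j = i then debias t c - bitVal (b i) else 1
  simp only [Finset.prod_ite_eq', Finset.mem_univ, if_true] at h
  rw [h]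
  refine Finset.prod_eq_zero (Finset.mem_univ i) ?_
  simpa using sum_flipProb_mul_debias ht (b i)

theorem sum_prod_flipProb_mul_debias_mul {t : ℝ} (ht : 0 < t) (b : Bits d) (i k : Fin d) :
    ∑ o : Bits d, (∏ j, flipProb t (b j) (o j)) *
      ((debias t (o i) - bitVal (b i)) * (debias t (o k) - bitVal (b k))) =
      if i = k then q t * (1 - q t) / (2 * q t - 1) ^ 2 else 0 := by
  have h := sum_prod_flipProb_mul_prod t b fun j c =>
    (if j = i then debias t c - bitVal (b i) else 1) *
      (if j = k then debias t c - bitVal (b k) else 1)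
  simp only [Finset.prod_mul_distrib, Finset.prod_ite_eq', Finset.mem_univ, if_true] at h
  rw [h]
  split_ifs with hik
  · subst hik
    rw [Finset.prod_eq_single i]
    · simpa using sum_flipProb_mul_debias_sq ht (b i)
    · intro j _ hj
      simp only [hj, if_false, mul_one, sum_flipProb]
    · simp
  · refine Finset.prod_eq_zero (Finset.mem_univ i) ?_
    simpa [hik] using sum_flipProb_mul_debias ht (b i)

end Moments

/-! ### Mean and covariance of the observation function. -/

section JointLaw

variable {Y : Type*} {d : ℕ}

theorem jointLaw_apply {O : Type*} (p : PMF Y) (S : Y → PMF O) (y : Y) (o : O) :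
    jointLaw p S (y, o) = p y * S y o := by
  classical
  simp only [jointLaw, PMF.bind_apply, PMF.map_apply, Prod.mk.injEq]
  rw [tsum_eq_single y, tsum_eq_single o]
  · simp
  · intro o' ho'
    simp [ho'.symm]
  · intro y' hy'
    simp [hy'.symm]

variable [Fintype Y] [Nonempty Y] [MeasurableSpace Y] [MeasurableSingletonClass Y]
  {φ : Y → EuclideanSpace ℝ (Fin d)}

theorem integral_jointLaw (hφ : ∀ y j, φ y j = 0 ∨ φ y j = 1) (θ : EuclideanSpace ℝ (Fin d))
    (α δ' : ℝ) {E : Type*} [NormedAddCommGroup E] [NormedSpace ℝ E] [CompleteSpace E]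
    (f : Y × Bits d → E) :
    ∫ z, f z ∂(jointLaw (model φ θ) (perValueRR 1 α δ' φ)).toMeasure =
      ∑ y, density φ θ y •
        ∑ o, (∏ j, flipProb (α / δ') (featureBits φ y j) (o j)) • f (y, o) := by
  have hnonneg : ∀ y (o : Bits d), 0 ≤ ∏ j, flipProb (α / δ') (featureBits φ y j) (o j) :=
    fun y o => Finset.prod_nonneg fun j _ => (flipProb_pos _ _ _).le
  rw [PMF.integral_eq_sum, Fintype.sum_prod_type]
  simp_rw [Finset.smul_sum, jointLaw_apply, ENNReal.toReal_mul, toReal_model, perValueRR_apply hφ,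
    ENNReal.toReal_ofReal (hnonneg _ _), smul_smul]

theorem obsFun_apply (α δ' : ℝ) (o : Bits d) (j : Fin d) :
    obsFun 1 α δ' o j = debias (α / δ') (o j) := by
  simp [obsFun, debias]

theorem integral_obsFun (hφ : ∀ y j, φ y j = 0 ∨ φ y j = 1) (θ : EuclideanSpace ℝ (Fin d))
    {α δ' : ℝ} (ht : 0 < α / δ') :
    ∫ z, obsFun 1 α δ' z.2 ∂(jointLaw (model φ θ) (perValueRR 1 α δ' φ)).toMeasure =
      meanParam φ θ := by
  rw [integral_jointLaw hφ, meanParam]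
  refine Finset.sum_congr rfl fun y _ => congrArg _ ?_
  ext i
  have h := sum_prod_flipProb_mul_debias ht (featureBits φ y) i
  simp_rw [mul_sub, Finset.sum_sub_distrib, ← Finset.sum_mul, sum_prod_flipProb, one_mul,
    bitVal_featureBits hφ] at h
  simpa [obsFun_apply] using sub_eq_zero.1 h

/-- Law of total covariance: the conditional mean `φ(y)` contributes the Fisher information, and the
noise contributes the same diagonal matrix for every `y`. -/
theorem covariance_obsFun (hφ : ∀ y j, φ y j = 0 ∨ φ y j = 1) (θ : EuclideanSpace ℝ (Fin d))
    {α δ' : ℝ} (ht : 0 < α / δ') (i k : Fin d) :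
    cov[fun z => obsFun 1 α δ' z.2 i, fun z => obsFun 1 α δ' z.2 k;
      (jointLaw (model φ θ) (perValueRR 1 α δ' φ)).toMeasure] =
      (fisherInfo φ θ + lossMatrix d α δ') i k := by
  have hmean : ∀ i, ∫ z, obsFun 1 α δ' z.2 i
      ∂(jointLaw (model φ θ) (perValueRR 1 α δ' φ)).toMeasure = meanParam φ θ i := by
    intro i
    rw [← integral_obsFun hφ θ ht]
    exact (EuclideanSpace.proj (𝕜 := ℝ) i).integral_comp_comm (φ := fun z : Y × Bits d =>
      obsFun 1 α δ' z.2) .of_finite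
  have hinner : ∀ y, ∑ o : Bits d, (∏ j, flipProb (α / δ') (featureBits φ y j) (o j)) *
      ((debias (α / δ') (o i) - meanParam φ θ i) * (debias (α / δ') (o k) - meanParam φ θ k)) =
      (φ y i - meanParam φ θ i) * (φ y k - meanParam φ θ k) + lossMatrix d α δ' i k := by
    intro y
    have h0 := sum_prod_flipProb (α / δ') (featureBits φ y)
    have h1 := sum_prod_flipProb_mul_debias ht (featureBits φ y) i
    have h2 := sum_prod_flipProb_mul_debias ht (featureBits φ y) k
    have h3 := sum_prod_flipProb_mul_debias_mul ht (featureBits φ y) i k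
    simp only [bitVal_featureBits hφ] at h1 h2 h3
    have hloss : lossMatrix d α δ' i k =
        if i = k then q (α / δ') * (1 - q (α / δ')) / (2 * q (α / δ') - 1) ^ 2 else 0 := by
      simp [lossMatrix, Matrix.one_apply]
    rw [hloss, ← h3]
    -- Each factor is split as (debiased bit - `φ y`) + (`φ y` - mean); the two cross terms vanish
    -- because the noise is centred given `y`.
    calc _ = ∑ o : Bits d, ((∏ j, flipProb (α / δ') (featureBits φ y j) (o j)) *
            ((debias (α / δ') (o i) - φ y i) * (debias (α / δ') (o k) - φ y k)) +
          (φ y k - meanParam φ θ k) * ((∏ j, flipProb (α / δ') (featureBits φ y j) (o j)) *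
            (debias (α / δ') (o i) - φ y i)) +
          (φ y i - meanParam φ θ i) * ((∏ j, flipProb (α / δ') (featureBits φ y j) (o j)) *
            (debias (α / δ') (o k) - φ y k)) +
          (φ y i - meanParam φ θ i) * (φ y k - meanParam φ θ k) *
            ∏ j, flipProb (α / δ') (featureBits φ y j) (o j)) :=
          Finset.sum_congr rfl fun o _ => by ring
      _ = _ := by
          simp only [Finset.sum_add_distrib, ← Finset.mul_sum, h0, h1, h2]
          ring
  rw [covariance, hmean, hmean, integral_jointLaw hφ]
  simp only [obsFun_apply, smul_eq_mul, hinner, mul_add, Finset.sum_add_distrib, ← Finset.sum_mul,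
    sum_density_eq_one, one_mul, Matrix.add_apply, fisherInfo_apply]

/-- The variance of a linear functional of the observation function. -/
theorem variance_inner_obsFun (hφ : ∀ y j, φ y j = 0 ∨ φ y j = 1) (θ : EuclideanSpace ℝ (Fin d))
    {α δ' : ℝ} (ht : 0 < α / δ') (w : EuclideanSpace ℝ (Fin d)) :
    Var[fun z => inner ℝ (obsFun 1 α δ' z.2) w;
      (jointLaw (model φ θ) (perValueRR 1 α δ' φ)).toMeasure] =
      w.ofLp ⬝ᵥ (fisherInfo φ θ + lossMatrix d α δ').mulVec w.ofLp := by
  have hmem : ∀ j, MemLp (fun z : Y × Bits d => obsFun 1 α δ' z.2 j * w j) 2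
      (jointLaw (model φ θ) (perValueRR 1 α δ' φ)).toMeasure := fun j => .of_discrete
  have hsum : (fun z : Y × Bits d => inner ℝ (obsFun 1 α δ' z.2) w) =
      fun z => ∑ j, obsFun 1 α δ' z.2 j * w j := by
    ext z
    simp [PiLp.inner_apply, mul_comm]
  rw [hsum, ← covariance_self (by fun_prop), covariance_fun_sum_fun_sum hmem hmem]
  simp only [covariance_mul_const_left, covariance_mul_const_right, covariance_obsFun hφ θ ht,
    dotProduct, Matrix.mulVec, Finset.mul_sum]
  exact Finset.sum_congr rfl fun i _ => Finset.sum_congr rfl fun k _ => by ring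

theorem posSemidef_fisherInfo_add_lossMatrix (hφ : ∀ y j, φ y j = 0 ∨ φ y j = 1)
    (θ : EuclideanSpace ℝ (Fin d)) {α δ' : ℝ} (ht : 0 < α / δ') :
    (fisherInfo φ θ + lossMatrix d α δ').PosSemidef := by
  refine Matrix.PosSemidef.of_dotProduct_mulVec_nonneg ?_ fun w => ?_
  · ext i k
    simp only [Matrix.conjTranspose_apply, star_trivial, ← covariance_obsFun hφ θ ht]
    exact covariance_comm _ _
  · have := variance_inner_obsFun hφ θ ht (WithLp.toLp 2 w)
    rw [star_trivial]
    exact this ▸ variance_nonneg _ _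

end JointLaw

end PerValueRR

/-! ### Privacy and asymptotic normality of the estimator. -/

theorem mainTheorem5 {Y : Type*} [Fintype Y] [Nonempty Y] [MeasurableSpace Y]
    [MeasurableSingletonClass Y] {d : ℕ}
    -- binary features, true parameter, nonsingular Fisher information
    (φ : Y → EuclideanSpace ℝ (Fin d)) (hφ : ∀ y j, φ y j = 0 ∨ φ y j = 1)
    (θstar : EuclideanSpace ℝ (Fin d)) (hI : IsUnit (PerValueRR.fisherInfo φ θstar))
    -- privacy level and upper bound on the norm of the binarized statistics
    (α δ' : ℝ) (hα : 0 < α) (hδ' : 0 < δ') (hδ : PerValueRR.normBound 1 φ ≤ δ')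
    -- i.i.d. pairs of a label drawn from the model and its privatized observation
    {Ω : Type*} [MeasurableSpace Ω] (P : Measure Ω) [IsProbabilityMeasure P]
    (Z : ℕ → Ω → Y × PerValueRR.Bits d)
    (hZ_indep : iIndepFun Z P)
    (hZ_law : ∀ i, HasLaw (Z i)
      (PerValueRR.jointLaw (PerValueRR.model φ θstar)
        (PerValueRR.perValueRR 1 α δ' φ)).toMeasure P)
    -- the moments-based estimator, a function of the observations alone
    (est : (n : ℕ) → (Fin n → PerValueRR.Bits d) → EuclideanSpace ℝ (Fin d))
    (hest : PerValueRR.IsMomentEstimator φ (PerValueRR.obsFun 1 α δ') est) :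
    PerValueRR.IsDifferentiallyPrivate α (PerValueRR.perValueRR 1 α δ' φ) ∧
    TendstoInDistribution
      (fun (n : ℕ) ω => √(n : ℝ) • (est n (fun i : Fin n => (Z i ω).2) - θstar))
      atTop id (fun _ => P)
      (multivariateGaussian 0
        ((PerValueRR.fisherInfo φ θstar)⁻¹ +
          (PerValueRR.fisherInfo φ θstar)⁻¹ * PerValueRR.lossMatrix d α δ' *
            (PerValueRR.fisherInfo φ θstar)⁻¹)) := by
  refine ⟨PerValueRR.isDifferentiallyPrivate_perValueRR hφ hα.le hδ' hδ, ?_⟩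
  have ht : 0 < α / δ' := div_pos hα hδ'
  set I := PerValueRR.fisherInfo φ θstar with hIdef
  set H := PerValueRR.lossMatrix d α δ' with hH
  set J := (PerValueRR.jointLaw (PerValueRR.model φ θstar)
    (PerValueRR.perValueRR 1 α δ' φ)).toMeasure with hJ
  have hpsd : (I + H).PosSemidef := PerValueRR.posSemidef_fisherInfo_add_lossMatrix hφ θstar ht
  have hdet := (Matrix.isUnit_iff_isUnit_det _).1 hI
  -- Sandwich form of the covariance, as the delta method delivers it; the Fisher information is
  -- symmetric.
  have hcov : I⁻¹ + I⁻¹ * H * I⁻¹ = I⁻¹ * (I + H) * I⁻¹.transpose := by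
    have hsymm : I.transpose = I := by
      ext i j
      simp only [hIdef, Matrix.transpose_apply, PerValueRR.fisherInfo, Matrix.of_apply]
      exact covariance_comm _ _
    rw [Matrix.transpose_nonsing_inv, hsymm, Matrix.mul_add, Matrix.nonsing_inv_mul _ hdet,
      Matrix.add_mul, Matrix.one_mul]
  set X : ℕ → Ω → EuclideanSpace ℝ (Fin d) := fun i ω => PerValueRR.obsFun 1 α δ' (Z i ω).2
  have hβ : Measurable fun z : Y × PerValueRR.Bits d => PerValueRR.obsFun 1 α δ' z.2 :=
    measurable_of_finite _
  have hident : ∀ i, IdentDistrib (X i) (X 0) P P := fun i =>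
    (IdentDistrib.mk (hZ_law i).aemeasurable (hZ_law 0).aemeasurable
      ((hZ_law i).map_eq.trans (hZ_law 0).map_eq.symm)).comp hβ
  have hindep : iIndepFun X P := hZ_indep.comp (fun _ z => PerValueRR.obsFun 1 α δ' z.2) fun _ => hβ
  have hmem : MemLp (X 0) 2 P := by
    have h : MemLp (fun z : Y × PerValueRR.Bits d => PerValueRR.obsFun 1 α δ' z.2) 2
        (P.map (Z 0)) := by
      rw [(hZ_law 0).map_eq]
      exact .of_discrete
    exact h.comp_of_map (hZ_law 0).aemeasurable
  have hmean : P[X 0] = PerValueRR.meanParam φ θstar :=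
    ((hZ_law 0).integral_comp hβ.aestronglyMeasurable).trans
      (PerValueRR.integral_obsFun hφ θstar ht)
  have hvar : ∀ w, Var[fun ω => inner ℝ (X 0 ω) w; P] = w.ofLp ⬝ᵥ (I + H).mulVec w.ofLp := by
    intro w
    rw [← PerValueRR.variance_inner_obsFun hφ θstar ht w, ← hJ, ← (hZ_law 0).map_eq,
      variance_map (by fun_prop) (hZ_law 0).aemeasurable]
    rfl
  have hclt := PerValueRR.tendstoInDistribution_sqrt_smul_mean_sub
    (ν := multivariateGaussian 0 (I + H)) hmem hindep hident fun w => by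
      rw [charFun_multivariateGaussian hpsd, hvar]
      simp [neg_div]
  have hXsum : ∀ (n : ℕ) ω, (n : ℝ)⁻¹ • ∑ i ∈ Finset.range n, X i ω =
      PerValueRR.empMoment (PerValueRR.obsFun 1 α δ') fun i : Fin n => (Z i ω).2 := fun n ω => by
    rw [PerValueRR.empMoment, ← Fin.sum_univ_eq_sum_range (fun i => X i ω)]
  have hlln := strong_law_ae X (hmem.integrable one_le_two)
    (fun i j hij => hindep.indepFun hij) hident
  simp only [hmean, hXsum] at hclt hlln
  have hsample : ∀ n, AEMeasurable (fun ω => fun i : Fin n => (Z i ω).2) P := fun n =>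
    aemeasurable_pi_lambda _ fun i => measurable_snd.comp_aemeasurable (hZ_law i).aemeasurable
  obtain ⟨h, hh, hderiv, hmax⟩ := PerValueRR.exists_momentInverse φ θstar hI
  have hdelta := PerValueRR.tendstoInDistribution_delta (P := P) hderiv
    (X := fun n ω => PerValueRR.empMoment (PerValueRR.obsFun 1 α δ') fun i : Fin n => (Z i ω).2)
    (Θ := fun n ω => est n fun i : Fin n => (Z i ω).2)
    -- For each `n` the sample space is finite, so even an arbitrary choice of estimator is
    -- measurable.
    (fun n => (measurable_of_finite
      (PerValueRR.empMoment (PerValueRR.obsFun 1 α δ'))).comp_aemeasurable (hsample n))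
    (fun n => (measurable_of_finite (est n)).comp_aemeasurable (hsample n)) hlln
    (by
      -- Once the moment is in the good neighbourhood a maximizer exists, so the arbitrary values of
      -- `est` no longer occur, and uniqueness identifies `est` with `h`.
      filter_upwards [hlln] with ω hω
      filter_upwards [hω.eventually hmax] with n hn
      exact hn.2 _ (hest n _ ⟨_, hn.1⟩)) hclt
  rw [hh] at hdelta
  refine ⟨hdelta.forall_aemeasurable, aemeasurable_id, ?_⟩
  convert! hdelta.tendsto using 2
  refine congrArg 𝓝 (Subtype.ext ?_)
  simp only
  rw [Measure.map_id, hcov]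
  exact (PerValueRR.map_toEuclideanCLM_multivariateGaussian hpsd _).symm
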